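/- Let $\mathcal{B}$ be a complete Boolean algebra with unity $\mathbf{1}$, let $Q$ be its Stone space, and for $e\in\mathcal{B}$ let $Q(e)\subset Q$ be the corresponding clopen set. Let $C(Q)$ be the algebra of continuous functions $Q\to\mathbb{R}$, and let $L^0(\mathcal{B})=C_\infty(Q)$ be the set of all continuous functions $x\colon Q\to[-\infty,+\infty]$ that take the values $\pm\infty$ on a nowhere dense set only. It is a commutative $\mathbb{R}$-algebra and a vector lattice: the order is pointwise, and each algebraic operation gives the unique continuous extension of the function computed pointwise on the dense open set where the functions involved are finite. Identify $e\in\mathcal{B}$ with the indicator function of $Q(e)$, an idempotent of $L^0(\mathcal{B})$, and regard $C(Q)$ as a subalgebra of $L^0(\mathcal{B})$. The support of $x\in L^0(\mathcal{B})$ is $s(x)=\mathbf{1}-\sup\{e\in\mathcal{B}: ex=0\}\in\mathcal{B}$. A solid space in $L^0(\mathcal{B})$ is a non-zero linear subspace $Y$ such that $x\in Y$, $y\in L^0(\mathcal{B})$ and $|y|\leqslant|x|$ imply $y\in Y$. A derivation $\delta\colon C(Q)\to Y$ is an $\mathbb{R}$-linear map with $\delta(ab)=\delta(a)b+a\delta(b)$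 for all $a,b\in C(Q)$, the products being computed in $L^0(\mathcal{B})$; its support is $s(\delta)=\sup\{s(\delta(a)): a\in C(Q)\}\in\mathcal{B}$. **Theorem.** Let $\mathcal{B}$ be a complete Boolean algebra, let $Q$ be the Stone space of $\mathcal{B}$, let $Y$ be a solid space in $L^0(\mathcal{B})$ and let $\delta\colon C(Q)\to Y$ be a non-zero derivation. Then $s(\delta)Y=s(\delta)L^0(\mathcal{B})$, where $eE=\{ex: x\in E\}$ for $e\in\mathcal{B}$ and $E\subset L^0(\mathcal{B})$. In particular, if $s(\delta)=\mathbf{1}$, then $Y=L^0(\mathcal{B})$. -/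

import Mathlib

open Set Filter Topology

noncomputable section

universe u

/-! ## The Stone space of a Boolean algebra -/

/-- The Stone space of a Boolean algebra `B`: its points are the Boolean homomorphisms
`B → {0, 1}` (equivalently, the ultrafilters of `B`). -/
def StoneSpace (B : Type u) [BooleanAlgebra B] : Type u := BoundedLatticeHom B Bool

namespace StoneSpace

section Boolean

variable {B : Type u} [BooleanAlgebra B]

/-- The value of a point of the Stone space, seen as a homomorphism, at `e`. -/
def val (t : StoneSpace B) : B → Bool := fun e => BoundedLatticeHom.toLatticeHom t e

/-- The topology of pointwise convergence. -/
instance : TopologicalSpace (StoneSpace B) := TopologicalSpace.induced val inferInstance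

/-- The set `Q(e)` of all points of the Stone space at which `e` takes the value `1`. -/
def basic (e : B) : Set (StoneSpace B) := {t | t.val e = true}

lemma val_injective : Function.Injective (val : StoneSpace B → B → Bool) := by
  intro s t h
  apply DFunLike.ext (F := BoundedLatticeHom B Bool) s t
  intro e
  exact congrFun h e

lemma val_sup (t : StoneSpace B) (a b : B) : t.val (a ⊔ b) = (t.val a || t.val b) :=
  map_sup (BoundedLatticeHom.toLatticeHom t) a b

lemma val_inf (t : StoneSpace B) (a b : B) : t.val (a ⊓ b) = (t.val a && t.val b) :=
  map_inf (BoundedLatticeHom.toLatticeHom t) a b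

lemma val_top (t : StoneSpace B) : t.val ⊤ = true :=
  map_top (F := BoundedLatticeHom B Bool) t

lemma val_bot (t : StoneSpace B) : t.val ⊥ = false :=
  map_bot (F := BoundedLatticeHom B Bool) t

lemma val_compl (t : StoneSpace B) (a : B) : t.val aᶜ = !(t.val a) := by
  have h1 := val_sup t a aᶜ
  have h2 := val_inf t a aᶜ
  rw [sup_compl_eq_top, val_top] at h1
  rw [inf_compl_eq_bot, val_bot] at h2
  revert h1 h2
  cases t.val a <;> cases t.val aᶜ <;> simp

lemma continuous_val : Continuous (val : StoneSpace B → B → Bool) := continuous_induced_dom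

lemma isClopen_basic (e : B) : IsClopen (basic e) :=
  (isClopen_discrete {true}).preimage ((continuous_apply e).comp continuous_val)

lemma basic_compl (e : B) : basic eᶜ = (basic e)ᶜ := by
  ext t
  simp [basic, val_compl]

lemma basic_inf (a b : B) : basic (a ⊓ b) = basic a ∩ basic b := by
  ext t
  simp [basic, val_inf]

lemma range_val : range (val : StoneSpace B → B → Bool) =
    {f | f ⊤ = true ∧ f ⊥ = false ∧ ∀ a b, f (a ⊔ b) = (f a || f b) ∧
      f (a ⊓ b) = (f a && f b)} := by
  ext f
  constructor
  · rintro ⟨t, rfl⟩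
    exact ⟨val_top t, val_bot t, fun a b => ⟨val_sup t a b, val_inf t a b⟩⟩
  · rintro ⟨h1, h2, h3⟩
    exact ⟨({ toFun := f
              map_sup' := fun a b => (h3 a b).1
              map_inf' := fun a b => (h3 a b).2
              map_top' := h1
              map_bot' := h2 } : BoundedLatticeHom B Bool), rfl⟩

instance : T2Space (StoneSpace B) :=
  T2Space.of_injective_continuous val_injective continuous_val

instance : CompactSpace (StoneSpace B) := by
  have hi : IsInducing (val : StoneSpace B → B → Bool) := ⟨rfl⟩
  rw [← isCompact_univ_iff, hi.isCompact_iff, image_univ, range_val]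
  apply IsClosed.isCompact
  simp only [ofPred_and, ofPred_forall]
  refine (isClosed_eq (continuous_apply _) continuous_const).inter
    ((isClosed_eq (continuous_apply _) continuous_const).inter
      (isClosed_iInter fun a => isClosed_iInter fun b => IsClosed.inter ?_ ?_))
  · exact isClosed_eq (continuous_apply _)
      (continuous_of_discreteTopology (f := fun p : Bool × Bool => (p.1 || p.2)) |>.comp
        (g := fun p : Bool × Bool => (p.1 || p.2)) (f := fun f : B → Bool => (f a, f b))
        ((continuous_apply a).prodMk (continuous_apply b)))
  · exact isClosed_eq (continuous_apply _)
      (continuous_of_discreteTopology (f := fun p : Bool × Bool => (p.1 && p.2)) |>.comp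
        (g := fun p : Bool × Bool => (p.1 && p.2)) (f := fun f : B → Bool => (f a, f b))
        ((continuous_apply a).prodMk (continuous_apply b)))

lemma basic_nonempty {e : B} (he : e ≠ ⊥) : (basic e).Nonempty := by
  classical
  have hd : Disjoint ((Order.PFilter.principal e : Order.PFilter B) : Set B)
      ((Order.Ideal.principal (⊥ : B)) : Set B) := by
    rw [Set.disjoint_left]
    intro x hx hx'
    have h1 : e ≤ x := hx
    have h2 : x ≤ ⊥ := hx'
    exact he (le_bot_iff.1 (h1.trans h2))
  obtain ⟨J, hJ, -, hdJ⟩ := DistribLattice.prime_ideal_of_disjoint_filter_ideal hd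
  have heJ : e ∉ J := fun h => Set.disjoint_left.1 hdJ (le_refl e) h
  have htop : (⊤ : B) ∉ J := fun h => heJ (J.lower le_top h)
  refine ⟨({ toFun := fun x => decide (x ∉ J)
             map_sup' := fun a b => ?_
             map_inf' := fun a b => ?_
             map_top' := ?_
             map_bot' := ?_ } : BoundedLatticeHom B Bool), ?_⟩
  · by_cases ha : a ∈ J <;> by_cases hb : b ∈ J <;> simp [Order.Ideal.sup_mem_iff, ha, hb]
  · have h : a ⊓ b ∈ J ↔ a ∈ J ∨ b ∈ J :=
      ⟨fun h => hJ.mem_or_mem h, fun h => h.elim (J.lower inf_le_left) (J.lower inf_le_right)⟩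
    by_cases ha : a ∈ J <;> by_cases hb : b ∈ J <;> simp [h, ha, hb]
  · simpa using htop
  · simp
  · change decide (e ∉ J) = true
    simpa using heJ

/-- The sets `Q(e)` form a base of the topology. -/
lemma exists_basic_subset {U : Set (StoneSpace B)} (hU : IsOpen U) {t : StoneSpace B}
    (ht : t ∈ U) : ∃ e : B, t ∈ basic e ∧ basic e ⊆ U := by
  obtain ⟨V, hV, rfl⟩ := isOpen_induced_iff.1 hU
  obtain ⟨I, w, hw, hsub⟩ := isOpen_pi_iff.1 hV _ ht
  have key : ∀ I : Finset B, ∃ e : B, t ∈ basic e ∧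
      ∀ s ∈ basic e, ∀ a ∈ I, s.val a = t.val a := by
    classical
    intro I
    induction I using Finset.induction_on with
    | empty => exact ⟨⊤, val_top t, by simp⟩
    | insert a I _ ih =>
      obtain ⟨e, he, hI⟩ := ih
      have ha : ∃ c : B, t ∈ basic c ∧ ∀ s ∈ basic c, s.val a = t.val a := by
        cases h : t.val a
        · refine ⟨aᶜ, ?_, fun s hs => ?_⟩
          · simp [basic, val_compl, h]
          · simpa [basic, val_compl] using hs
        · exact ⟨a, h, fun s hs => hs⟩
      obtain ⟨c, hc, hca⟩ := ha
      refine ⟨e ⊓ c, ?_, fun s hs b hb => ?_⟩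
      · rw [basic_inf]
        exact ⟨he, hc⟩
      · rw [basic_inf] at hs
        rcases Finset.mem_insert.1 hb with rfl | hb
        · exact hca s hs.2
        · exact hI s hs.1 b hb
  obtain ⟨e, he, hI⟩ := key I
  refine ⟨e, he, fun s hs => hsub ?_⟩
  intro a ha
  rw [hI s hs a ha]
  exact (hw a ha).2

end Boolean

/-- The Stone space of a complete Boolean algebra is extremally disconnected. -/
instance {B : Type u} [CompleteBooleanAlgebra B] : ExtremallyDisconnected (StoneSpace B) where
  open_closure U hU := by
    have h : closure U = basic (sSup {e : B | basic e ⊆ U}) := by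
      apply Subset.antisymm
      · refine closure_minimal (fun t ht => ?_) (isClopen_basic _).1
        obtain ⟨e, he, heU⟩ := exists_basic_subset hU ht
        have hle : e ≤ sSup {e : B | basic e ⊆ U} := le_sSup heU
        have h2 := val_inf t e (sSup {e : B | basic e ⊆ U})
        rw [inf_eq_left.2 hle, show t.val e = true from he] at h2
        simpa [basic] using h2.symm
      · intro t ht
        by_contra hcl
        obtain ⟨c, hc, hcU⟩ := exists_basic_subset isClosed_closure.isOpen_compl hcl
        have hsup : sSup {e : B | basic e ⊆ U} ≤ cᶜ := by
          refine sSup_le fun e he => ?_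
          rw [le_compl_iff_disjoint_right, disjoint_iff]
          by_contra hne
          obtain ⟨s, hs⟩ := basic_nonempty hne
          rw [basic_inf] at hs
          exact hcU hs.2 (subset_closure (he hs.1))
        have h2 := val_inf t (sSup {e : B | basic e ⊆ U}) cᶜ
        rw [inf_eq_left.2 hsup, show t.val _ = true from ht, val_compl,
          show t.val c = true from hc] at h2
        simp at h2
    rw [h]
    exact (isClopen_basic _).2

end StoneSpace

/-! ## The algebra and vector lattice `C_∞(Q)` -/

/-- `C_∞(Q)`: the continuous functions `x : Q → [-∞, +∞]` that take the values `±∞` on a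
nowhere dense set only. -/
structure CInfty (Q : Type u) [TopologicalSpace Q] : Type u where
  toFun : Q → EReal
  continuous_toFun : Continuous toFun
  nowhereDense : IsNowhereDense {t | toFun t = ⊥ ∨ toFun t = ⊤}

namespace CInfty

section Basic

variable {Q : Type u} [TopologicalSpace Q]

instance : CoeFun (CInfty Q) (fun _ => Q → EReal) := ⟨toFun⟩

lemma coe_injective : Function.Injective (toFun : CInfty Q → Q → EReal) := by
  rintro ⟨x, _, _⟩ ⟨y, _, _⟩ h
  cases h
  rfl

/-- The set of points at which `x` is finite. -/
def fin (x : CInfty Q) : Set Q := {t | x t ≠ ⊥ ∧ x t ≠ ⊤}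

/-- The real value of `x` (meaningful at the points where `x` is finite). -/
def re (x : CInfty Q) (t : Q) : ℝ := (x t).toReal

lemma coe_re (x : CInfty Q) {t : Q} (ht : t ∈ x.fin) : ((x.re t : ℝ) : EReal) = x t :=
  EReal.coe_toReal ht.2 ht.1

lemma isOpen_fin (x : CInfty Q) : IsOpen x.fin :=
  (isOpen_ne.preimage x.continuous_toFun).inter (isOpen_ne.preimage x.continuous_toFun)

lemma dense_fin (x : CInfty Q) : Dense x.fin := by
  have h := x.nowhereDense
  have hc : {t | x t = ⊥ ∨ x t = ⊤} = x.finᶜ := by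
    ext t
    simp only [fin, mem_ofPred_eq, mem_compl_iff]
    tauto
  rw [hc, IsNowhereDense, x.isOpen_fin.isClosed_compl.closure_eq, interior_compl] at h
  rw [dense_iff_closure_eq]
  simpa using h

lemma continuousOn_re (x : CInfty Q) : ContinuousOn x.re x.fin :=
  EReal.continuousOn_toReal.comp x.continuous_toFun.continuousOn (fun t ht => by
    have h1 := ht.1
    have h2 := ht.2
    simp [h1, h2])

lemma isNowhereDense_compl {D : Set Q} (hD : IsOpen D) (hd : Dense D) {s : Set Q}
    (hs : s ⊆ Dᶜ) : IsNowhereDense s := by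
  refine IsNowhereDense.mono hs ?_
  rw [IsNowhereDense, hD.isClosed_compl.closure_eq, interior_compl, hd.closure_eq, compl_univ]

/-- Two elements which agree on a dense set are equal. -/
lemma ext_dense {x y : CInfty Q} {D : Set Q} (hd : Dense D) (h : ∀ t ∈ D, x t = y t) :
    x = y :=
  coe_injective (Continuous.ext_on hd x.continuous_toFun y.continuous_toFun h)

/-- The order of `C_∞(Q)` is the pointwise one. -/
instance : LE (CInfty Q) := ⟨fun x y => ∀ t, x t ≤ y t⟩

instance : LT (CInfty Q) := ⟨fun x y => x ≤ y ∧ ¬ y ≤ x⟩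

instance : Max (CInfty Q) := ⟨fun x y =>
  ⟨fun t => max (x t) (y t), x.continuous_toFun.max y.continuous_toFun,
    isNowhereDense_compl (x.isOpen_fin.inter y.isOpen_fin)
      (x.dense_fin.inter_of_isOpen_left y.dense_fin x.isOpen_fin) (by
        rintro t ht ⟨h1, h2⟩
        rcases max_choice (x t) (y t) with h | h
        · rw [mem_ofPred_eq, h] at ht
          exact ht.elim h1.1 h1.2
        · rw [mem_ofPred_eq, h] at ht
          exact ht.elim h2.1 h2.2)⟩⟩

instance : Min (CInfty Q) := ⟨fun x y =>
  ⟨fun t => min (x t) (y t), x.continuous_toFun.min y.continuous_toFun,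
    isNowhereDense_compl (x.isOpen_fin.inter y.isOpen_fin)
      (x.dense_fin.inter_of_isOpen_left y.dense_fin x.isOpen_fin) (by
        rintro t ht ⟨h1, h2⟩
        rcases min_choice (x t) (y t) with h | h
        · rw [mem_ofPred_eq, h] at ht
          exact ht.elim h1.1 h1.2
        · rw [mem_ofPred_eq, h] at ht
          exact ht.elim h2.1 h2.2)⟩⟩

/-- The lattice structure of `C_∞(Q)` is the pointwise one. -/
instance : Lattice (CInfty Q) :=
  Function.Injective.lattice (toFun : CInfty Q → Q → EReal) coe_injective
    Iff.rfl (by intro x y; exact lt_iff_le_not_ge) (fun _ _ => rfl) (fun _ _ => rfl)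

/-- A continuous real-valued function, as an element of `C_∞(Q)`. -/
def ofC (f : C(Q, ℝ)) : CInfty Q where
  toFun t := ((f t : ℝ) : EReal)
  continuous_toFun := continuous_coe_real_ereal.comp f.continuous
  nowhereDense := by simp

lemma fin_ofC (f : C(Q, ℝ)) : (ofC f).fin = univ := by
  ext t
  simp [fin, ofC]

@[simp] lemma re_ofC (f : C(Q, ℝ)) (t : Q) : (ofC f).re t = f t := EReal.toReal_coe _

instance : Zero (CInfty Q) := ⟨ofC 0⟩

instance : One (CInfty Q) := ⟨ofC 1⟩

/-- The filter of the sets which contain a dense open set. -/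
def denseOpen (Q : Type u) [TopologicalSpace Q] : Filter Q where
  sets := {s | ∃ D ⊆ s, IsOpen D ∧ Dense D}
  univ_sets := ⟨univ, subset_rfl, isOpen_univ, dense_univ⟩
  sets_of_superset := by
    rintro s s' ⟨D, hDs, h⟩ hs
    exact ⟨D, hDs.trans hs, h⟩
  inter_sets := by
    rintro s s' ⟨D, hDs, hD, hd⟩ ⟨D', hDs', hD', hd'⟩
    exact ⟨D ∩ D', inter_subset_inter hDs hDs', hD.inter hD',
      hd.inter_of_isOpen_left hd' hD⟩

lemma eventually_fin (x : CInfty Q) : ∀ᶠ t in denseOpen Q, t ∈ x.fin :=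
  ⟨x.fin, subset_rfl, x.isOpen_fin, x.dense_fin⟩

/-- Elements with the same real values on a dense open set are equal. -/
lemma ext_re {x y : CInfty Q} (h : x.re =ᶠ[denseOpen Q] y.re) : x = y := by
  obtain ⟨D, hDs, -, hd⟩ := (h.and (x.eventually_fin.and y.eventually_fin))
  refine ext_dense hd fun t ht => ?_
  obtain ⟨h1, h2, h3⟩ := hDs ht
  rw [← coe_re x h2, ← coe_re y h3, h1]

@[simp] lemma re_zero (t : Q) : (0 : CInfty Q).re t = 0 := re_ofC 0 t

@[simp] lemma re_one (t : Q) : (1 : CInfty Q).re t = 1 := re_ofC 1 t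

end Basic

section Algebra

variable {Q : Type u} [TopologicalSpace Q] [ExtremallyDisconnected Q]

/-- In an extremally disconnected space a function which is continuous on a dense open set and
has values in a compact Hausdorff space has a limit at every point. -/
lemma exists_tendsto {K : Type*} [TopologicalSpace K] [CompactSpace K] [T2Space K]
    {D : Set Q} (hD : IsOpen D) (hd : Dense D) {f : Q → K} (hf : ContinuousOn f D) (t : Q) :
    ∃ y, Tendsto f (𝓝[D] t) (𝓝 y) := by
  have : (𝓝[D] t).NeBot := mem_closure_iff_nhdsWithin_neBot.1 (hd t)
  obtain ⟨c, hc⟩ := exists_clusterPt_of_compactSpace (map f (𝓝[D] t))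
  refine ⟨c, le_nhds_of_unique_clusterPt fun c' hc' => ?_⟩
  by_contra hne
  obtain ⟨V, W, hV, hW, hcV, hcW, hVW⟩ := t2_separation hne
  have key : ∀ {a : K} {U : Set K}, IsOpen U → a ∈ U → ClusterPt a (map f (𝓝[D] t)) →
      t ∈ closure (D ∩ f ⁻¹' U) := by
    intro a U hU ha hcl
    have h1 : ∃ᶠ z in map f (𝓝[D] t), z ∈ U :=
      hcl.frequently (hU.mem_nhds ha)
    rw [frequently_map, frequently_nhdsWithin_iff] at h1
    rw [mem_closure_iff_frequently]
    exact h1.mono fun z hz => ⟨hz.2, hz.1⟩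
  have h1 := key hV hcV hc'
  have h2 := key hW hcW hc
  have hdis : Disjoint (D ∩ f ⁻¹' V) (D ∩ f ⁻¹' W) :=
    (hVW.preimage f).mono inter_subset_right inter_subset_right
  have o1 := hf.isOpen_inter_preimage hD hV
  have o2 := hf.isOpen_inter_preimage hD hW
  have h3 := (hdis.closure_right o1).closure_left (ExtremallyDisconnected.open_closure _ o2)
  exact Set.disjoint_left.1 h3 h1 h2

/-- The element of `C_∞(Q)` which extends a real function that is continuous on a dense open
set `D` (see `lift_apply`); it is unique by `ext_dense`. -/
def lift (D : Set Q) (hD : IsOpen D) (hd : Dense D) (f : Q → ℝ) (hf : ContinuousOn f D) :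
    CInfty Q where
  toFun := extendFrom D (fun t => ((f t : ℝ) : EReal))
  continuous_toFun := continuous_extendFrom hd
    (exists_tendsto hD hd (continuous_coe_real_ereal.comp_continuousOn hf))
  nowhereDense := isNowhereDense_compl hD hd (by
    intro t ht htD
    have h : extendFrom D (fun t => ((f t : ℝ) : EReal)) t = ((f t : ℝ) : EReal) :=
      extendFrom_extends (continuous_coe_real_ereal.comp_continuousOn hf) t htD
    rw [mem_ofPred_eq, h] at ht
    simp at ht)

lemma lift_apply {D : Set Q} (hD : IsOpen D) (hd : Dense D) {f : Q → ℝ}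
    (hf : ContinuousOn f D) {t : Q} (ht : t ∈ D) : lift D hD hd f hf t = ((f t : ℝ) : EReal) :=
  extendFrom_extends (continuous_coe_real_ereal.comp_continuousOn hf) t ht

/-- The sum: the extension of the pointwise sum from the set where both functions are finite. -/
instance : Add (CInfty Q) := ⟨fun x y => lift (x.fin ∩ y.fin) (x.isOpen_fin.inter y.isOpen_fin)
  (x.dense_fin.inter_of_isOpen_left y.dense_fin x.isOpen_fin) (fun t => x.re t + y.re t)
  ((x.continuousOn_re.mono inter_subset_left).add (y.continuousOn_re.mono inter_subset_right))⟩

/-- The product: the extension of the pointwise product from the set where both functions are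
finite. -/
instance : Mul (CInfty Q) := ⟨fun x y => lift (x.fin ∩ y.fin) (x.isOpen_fin.inter y.isOpen_fin)
  (x.dense_fin.inter_of_isOpen_left y.dense_fin x.isOpen_fin) (fun t => x.re t * y.re t)
  ((x.continuousOn_re.mono inter_subset_left).mul (y.continuousOn_re.mono inter_subset_right))⟩

instance : Neg (CInfty Q) := ⟨fun x => lift x.fin x.isOpen_fin x.dense_fin (fun t => -x.re t)
  x.continuousOn_re.neg⟩

instance : SMul ℝ (CInfty Q) := ⟨fun c x => lift x.fin x.isOpen_fin x.dense_fin
  (fun t => c * x.re t) (continuousOn_const.mul x.continuousOn_re)⟩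

lemma re_lift {D : Set Q} (hD : IsOpen D) (hd : Dense D) {f : Q → ℝ}
    (hf : ContinuousOn f D) : (lift D hD hd f hf).re =ᶠ[denseOpen Q] f :=
  ⟨D, fun t ht => by
    change (lift D hD hd f hf t).toReal = f t
    rw [lift_apply hD hd hf ht, EReal.toReal_coe], hD, hd⟩

lemma re_add (x y : CInfty Q) : (x + y).re =ᶠ[denseOpen Q] fun t => x.re t + y.re t := re_lift ..

lemma re_mul (x y : CInfty Q) : (x * y).re =ᶠ[denseOpen Q] fun t => x.re t * y.re t := re_lift ..

lemma re_neg (x : CInfty Q) : (-x).re =ᶠ[denseOpen Q] fun t => -x.re t := re_lift ..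

lemma re_smul (c : ℝ) (x : CInfty Q) : (c • x).re =ᶠ[denseOpen Q] fun t => c * x.re t :=
  re_lift ..

instance : CommRing (CInfty Q) where
  add_assoc x y z := ext_re <| by
    filter_upwards [re_add (x + y) z, re_add x y, re_add x (y + z), re_add y z] with t h1 h2 h3 h4
    rw [h1, h2, h3, h4, add_assoc]
  zero_add x := ext_re <| by
    filter_upwards [re_add 0 x] with t h1
    rw [h1, re_zero, zero_add]
  add_zero x := ext_re <| by
    filter_upwards [re_add x 0] with t h1
    rw [h1, re_zero, add_zero]
  add_comm x y := ext_re <| by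
    filter_upwards [re_add x y, re_add y x] with t h1 h2
    rw [h1, h2, add_comm]
  neg_add_cancel x := ext_re <| by
    filter_upwards [re_add (-x) x, re_neg x] with t h1 h2
    rw [h1, h2, re_zero, neg_add_cancel]
  mul_assoc x y z := ext_re <| by
    filter_upwards [re_mul (x * y) z, re_mul x y, re_mul x (y * z), re_mul y z] with t h1 h2 h3 h4
    rw [h1, h2, h3, h4, mul_assoc]
  mul_comm x y := ext_re <| by
    filter_upwards [re_mul x y, re_mul y x] with t h1 h2
    rw [h1, h2, mul_comm]
  one_mul x := ext_re <| by
    filter_upwards [re_mul 1 x] with t h1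
    rw [h1, re_one, one_mul]
  mul_one x := ext_re <| by
    filter_upwards [re_mul x 1] with t h1
    rw [h1, re_one, mul_one]
  zero_mul x := ext_re <| by
    filter_upwards [re_mul 0 x] with t h1
    rw [h1, re_zero, zero_mul]
  mul_zero x := ext_re <| by
    filter_upwards [re_mul x 0] with t h1
    rw [h1, re_zero, mul_zero]
  left_distrib x y z := ext_re <| by
    filter_upwards [re_mul x (y + z), re_add y z, re_add (x * y) (x * z), re_mul x y, re_mul x z]
      with t h1 h2 h3 h4 h5
    rw [h1, h2, h3, h4, h5, mul_add]
  right_distrib x y z := ext_re <| by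
    filter_upwards [re_mul (x + y) z, re_add x y, re_add (x * z) (y * z), re_mul x z, re_mul y z]
      with t h1 h2 h3 h4 h5
    rw [h1, h2, h3, h4, h5, add_mul]
  nsmul := nsmulRec
  zsmul := zsmulRec

instance : Module ℝ (CInfty Q) where
  one_smul x := ext_re <| by
    filter_upwards [re_smul 1 x] with t h1
    rw [h1, one_mul]
  mul_smul a b x := ext_re <| by
    filter_upwards [re_smul (a * b) x, re_smul a (b • x), re_smul b x] with t h1 h2 h3
    rw [h1, h2, h3, mul_assoc]
  smul_zero a := ext_re <| by
    filter_upwards [re_smul a (0 : CInfty Q)] with t h1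
    rw [h1, re_zero, mul_zero]
  smul_add a x y := ext_re <| by
    filter_upwards [re_smul a (x + y), re_add x y, re_add (a • x) (a • y), re_smul a x,
      re_smul a y] with t h1 h2 h3 h4 h5
    rw [h1, h2, h3, h4, h5, mul_add]
  add_smul a b x := ext_re <| by
    filter_upwards [re_smul (a + b) x, re_add (a • x) (b • x), re_smul a x, re_smul b x]
      with t h1 h2 h3 h4
    rw [h1, h2, h3, h4, add_mul]
  zero_smul x := ext_re <| by
    filter_upwards [re_smul 0 x] with t h1
    rw [h1, re_zero, zero_mul]

instance : Algebra ℝ (CInfty Q) := Algebra.ofModule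
  (fun a x y => ext_re <| by
    filter_upwards [re_mul (a • x) y, re_smul a x, re_smul a (x * y), re_mul x y]
      with t h1 h2 h3 h4
    rw [h1, h2, h3, h4, mul_assoc])
  (fun a x y => ext_re <| by
    filter_upwards [re_mul x (a • y), re_smul a y, re_smul a (x * y), re_mul x y]
      with t h1 h2 h3 h4
    rw [h1, h2, h3, h4, mul_left_comm])

end Algebra

end CInfty

/-! ## `L⁰(B)`, supports, solid spaces and derivations -/

section Main

variable {B : Type u} [CompleteBooleanAlgebra B]

/-- `L⁰(B) = C_∞(Q)`, where `Q` is the Stone space of the complete Boolean algebra `B`. -/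
abbrev LZero (B : Type u) [CompleteBooleanAlgebra B] : Type u := CInfty (StoneSpace B)

namespace LZero

/-- The idempotent of `L⁰(B)` given by `e ∈ B`: the indicator function of the clopen set `Q(e)`. -/
def idem (e : B) : LZero B :=
  CInfty.ofC
    ⟨(StoneSpace.basic e).indicator (fun _ => (1 : ℝ)),
      (StoneSpace.isClopen_basic e).continuous_indicator continuous_const⟩

/-- The support `s(x) = 1 - sup {e ∈ B : e x = 0}` of an element of `L⁰(B)`. -/
def supp (x : LZero B) : B := (sSup {e : B | idem e * x = 0})ᶜ

/-- A solid space: a non-zero linear subspace `Y` of `L⁰(B)` such that `x ∈ Y` and `|y| ≤ |x|`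
imply `y ∈ Y`. -/
structure IsSolidSpace (Y : Submodule ℝ (LZero B)) : Prop where
  ne_bot : Y ≠ ⊥
  solid : ∀ x ∈ Y, ∀ y : LZero B, |y| ≤ |x| → y ∈ Y

/-- A linear map from `C(Q)` to a linear subspace `Y` of `L⁰(B)` is a derivation if it satisfies
the Leibniz rule (whose terms are computed in the algebra `L⁰(B)`). -/
def IsDerivation {Y : Submodule ℝ (LZero B)} (δ : C(StoneSpace B, ℝ) →ₗ[ℝ] Y) : Prop :=
  ∀ a b : C(StoneSpace B, ℝ),
    (δ (a * b) : LZero B) = (δ a : LZero B) * CInfty.ofC b + CInfty.ofC a * (δ b : LZero B)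

/-- The support `s(δ) = sup {s(δ(a)) : a ∈ C(Q)}` of a linear map from `C(Q)` to a linear subspace
of `L⁰(B)`. -/
def derivSupp {Y : Submodule ℝ (LZero B)} (δ : C(StoneSpace B, ℝ) →ₗ[ℝ] Y) : B :=
  ⨆ a : C(StoneSpace B, ℝ), supp (δ a : LZero B)

end LZero

end Main

end

/-!
Derivations vanish on constants and on idempotents, hence `δ a` on an open set depends only on `a`
on that set. Near a point `t` one may therefore replace `a` by a restriction of `a - a t` to a
neighbourhood so small that the function is bounded by `1`; since `a` may be rescaled first, the
values at `t` of `δ` on the unit ball of `C(Q)` are unbounded as soon as some `δ b` is finite and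
non-zero at `t`. So any `z ∈ L⁰(B)` supported in `s(δ)` is locally dominated by `δ` of functions in
the unit ball. On an extremally disconnected space a bounded family of such functions, chosen on
disjoint open sets with dense union, is mixed into one continuous function `a`, and locality of `δ`
gives `|z| ≤ |δ a|` everywhere.
-/

open CInfty StoneSpace

section Topology

lemma exists_pairwiseDisjoint_dense_sUnion {X : Type*} [TopologicalSpace X] {P : Set X → Prop}
    (hP : ∀ V, IsOpen V → V.Nonempty → ∃ U ⊆ V, IsOpen U ∧ U.Nonempty ∧ P U) :
    ∃ S : Set (Set X), (∀ U ∈ S, IsOpen U ∧ P U) ∧ S.PairwiseDisjoint id ∧ Dense (⋃₀ S) := by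
  obtain ⟨S, hS⟩ := zorn_subset
    {S : Set (Set X) | (∀ U ∈ S, IsOpen U ∧ P U) ∧ S.PairwiseDisjoint id} fun C hC hchain =>
      ⟨⋃₀ C, ⟨fun U ⟨T, hT, hU⟩ => (hC hT).1 U hU,
        (pairwiseDisjoint_sUnion hchain.directedOn).2 fun T hT => (hC hT).2⟩,
        fun _ => subset_sUnion_of_mem⟩
  refine ⟨S, hS.prop.1, hS.prop.2, ?_⟩
  by_contra hdense
  obtain ⟨U, hUS, hUo, hUne, hPU⟩ := hP (closure (⋃₀ S))ᶜ isClosed_closure.isOpen_compl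
    (nonempty_compl.2 fun h => hdense (dense_iff_closure_eq.2 h))
  have hdisj : Disjoint U (⋃₀ S) :=
    (disjoint_compl_left.mono_left hUS).mono_right subset_closure
  have hmem : U ∈ S := hS.mem_of_prop_insert
    ⟨forall_mem_insert.2 ⟨⟨hUo, hPU⟩, hS.prop.1⟩,
      hS.prop.2.insert fun T hT _ => hdisj.mono_right (subset_sUnion_of_mem hT)⟩
  exact hUne.ne_empty (disjoint_self.1 (hdisj.mono_right (subset_sUnion_of_mem hmem)))

lemma exists_continuousMap_eqOn_of_dense_iUnion {Q X ι : Type*} [TopologicalSpace Q]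
    [ExtremallyDisconnected Q] [TopologicalSpace X] [T2Space X] {K : Set X} (hK : IsCompact K)
    {U : ι → Set Q} (hU : ∀ i, IsOpen (U i)) (hdense : Dense (⋃ i, U i)) (A : ι → C(Q, X))
    (hAK : ∀ i t, A i t ∈ K) (hA : ∀ i j, EqOn (A i) (A j) (U i ∩ U j)) :
    ∃ a : C(Q, X), ∀ i, EqOn a (A i) (U i) := by
  have : CompactSpace K := isCompact_iff_compactSpace.1 hK
  rcases isEmpty_or_nonempty ι with hι | hι
  · have : IsEmpty Q := by
      rw [iUnion_of_empty] at hdense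
      exact not_nonempty_iff.1 fun _ => hdense.nonempty.ne_empty rfl
    exact ⟨⟨isEmptyElim, continuous_of_const isEmptyElim⟩, fun i => isEmptyElim i⟩
  choose! i hi using fun t (ht : t ∈ ⋃ i, U i) => mem_iUnion.1 ht
  let f : Q → K := fun t => ⟨A (i t) t, hAK _ t⟩
  have hfA : ∀ j, EqOn f (fun t => ⟨A j t, hAK j t⟩) (U j) := fun j t ht =>
    Subtype.ext (hA _ _ ⟨hi t (mem_iUnion.2 ⟨j, ht⟩), ht⟩)
  have hf : ContinuousOn f (⋃ i, U i) := ContinuousOn.iUnion_of_isOpen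
    (fun j => ((A j).continuous.subtype_mk _).continuousOn.congr (hfA j)) hU
  refine ⟨⟨fun t => (extendFrom (⋃ i, U i) f t : K), continuous_subtype_val.comp <|
    continuous_extendFrom hdense fun t => exists_tendsto (isOpen_iUnion hU) hdense hf t⟩,
    fun j t ht => ?_⟩
  change ((extendFrom (⋃ i, U i) f t : K) : X) = A j t
  rw [extendFrom_extends hf t (mem_iUnion.2 ⟨j, ht⟩), hfA j ht]

end Topology

namespace StoneSpace

lemma basic_top {B : Type*} [BooleanAlgebra B] : basic (⊤ : B) = univ :=
  eq_univ_of_forall val_top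

lemma basic_bot {B : Type*} [BooleanAlgebra B] : basic (⊥ : B) = ∅ := by
  rw [← compl_top, basic_compl, basic_top, compl_univ]

lemma basic_subset_basic {B : Type*} [BooleanAlgebra B] {a b : B} :
    basic a ⊆ basic b ↔ a ≤ b := by
  rw [← disjoint_compl_right_iff, ← disjoint_compl_right_iff (x := a), ← basic_compl,
    Set.disjoint_iff_inter_eq_empty, ← basic_inf, disjoint_iff]
  refine ⟨fun h => ?_, fun h => by rw [h, basic_bot]⟩
  by_contra hne
  exact (basic_nonempty hne).ne_empty h

lemma basic_sSup {B : Type*} [CompleteBooleanAlgebra B] (S : Set B) :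
    basic (sSup S) = closure (⋃ e ∈ S, basic e) := by
  refine Subset.antisymm (fun t ht => ?_) <| closure_minimal
    (iUnion₂_subset fun e he => basic_subset_basic.2 (le_sSup he)) (isClopen_basic _).isClosed
  by_contra hcl
  obtain ⟨c, htc, hc⟩ := exists_basic_subset isClosed_closure.isOpen_compl hcl
  have hle : sSup S ≤ cᶜ := sSup_le fun e he => basic_subset_basic.1 <| by
    rw [basic_compl, subset_compl_comm]
    exact hc.trans (compl_subset_compl.2 ((subset_biUnion_of_mem he).trans subset_closure))
  have htc' := basic_subset_basic.2 hle ht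
  rw [basic_compl] at htc'
  exact htc' htc

end StoneSpace

namespace CInfty

variable {Q : Type*} [TopologicalSpace Q] [ExtremallyDisconnected Q]

lemma ofC_mul (f g : C(Q, ℝ)) : ofC (f * g) = ofC f * ofC g := ext_re <| by
  filter_upwards [re_mul (ofC f) (ofC g)] with t ht
  simp only [ht, re_ofC, ContinuousMap.mul_apply]

lemma mul_apply_of_mem_fin {x y : CInfty Q} {t : Q} (hx : t ∈ x.fin) (hy : t ∈ y.fin) :
    (x * y) t = ((x.re t * y.re t : ℝ) : EReal) :=
  lift_apply _ _ _ ⟨hx, hy⟩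

lemma smul_apply_of_mem_fin (c : ℝ) {x : CInfty Q} {t : Q} (hx : t ∈ x.fin) :
    (c • x) t = ((c * x.re t : ℝ) : EReal) :=
  lift_apply _ _ _ hx

lemma neg_apply (x : CInfty Q) (t : Q) : (-x) t = -x t := by
  refine congrFun (Continuous.ext_on x.dense_fin (-x).continuous_toFun
    (continuous_neg.comp x.continuous_toFun) fun s hs => ?_) t
  rw [Function.comp_apply, ← coe_re x hs, ← EReal.coe_neg]
  exact lift_apply _ _ _ hs

lemma abs_apply (x : CInfty Q) (t : Q) : |x| t = (x t).abs := by
  change max (x t) ((-x) t) = _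
  rw [neg_apply]
  induction x t with
  | bot => simp
  | coe r => rw [EReal.coe_abs, ← EReal.coe_neg, ← EReal.coe_strictMono.monotone.map_max]; rfl
  | top => simp

end CInfty

namespace LZero

variable {B : Type*} [CompleteBooleanAlgebra B]

/-- The indicator function of `Q(e)` as an element of `C(Q)`; `idem e` is its image in `L⁰(B)`. -/
noncomputable def idemC (e : B) : C(StoneSpace B, ℝ) :=
  ⟨(basic e).indicator (fun _ => (1 : ℝ)),
    (isClopen_basic e).continuous_indicator continuous_const⟩

lemma idemC_mul_apply (e : B) (a : C(StoneSpace B, ℝ)) (t : StoneSpace B) :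
    (idemC e * a) t = (basic e).indicator a t := by
  by_cases ht : t ∈ basic e <;> simp [idemC, ht]

lemma isIdempotentElem_idemC (e : B) : IsIdempotentElem (idemC e) := by
  ext t
  by_cases ht : t ∈ basic e <;> simp [idemC, ht]

lemma isIdempotentElem_idem (e : B) : IsIdempotentElem (idem e) := by
  change ofC (idemC e) * ofC (idemC e) = ofC (idemC e)
  rw [← ofC_mul, isIdempotentElem_idemC]

lemma idem_mul_apply (e : B) (x : LZero B) (t : StoneSpace B) :
    (idem e * x) t = (basic e).indicator x t := by
  refine congrFun (Continuous.ext_on x.dense_fin (idem e * x).continuous_toFun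
    ((isClopen_basic e).continuous_indicator x.continuous_toFun) fun s hs => ?_) t
  have hfin : s ∈ (idem e).fin := by rw [idem, fin_ofC]; trivial
  rw [mul_apply_of_mem_fin hfin hs, idem, re_ofC]
  by_cases hse : s ∈ basic e <;> simp [hse, coe_re x hs]

lemma idem_top : idem (⊤ : B) = 1 := by
  rw [← mul_one (idem ⊤)]
  refine coe_injective (funext fun t => ?_)
  rw [idem_mul_apply, basic_top, indicator_univ]

lemma basic_supp (x : LZero B) : basic (supp x) = closure {t | x t ≠ 0} := by
  rw [supp, basic_compl, basic_sSup]
  refine Subset.antisymm (fun t ht => ?_) ?_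
  · by_contra hcl
    obtain ⟨e, hte, he⟩ := exists_basic_subset isClosed_closure.isOpen_compl hcl
    have hex : idem e * x = 0 := coe_injective <| funext fun s => by
      rw [idem_mul_apply]
      refine indicator_apply_eq_zero.2 fun hs => ?_
      by_contra hxs
      exact he hs (subset_closure hxs)
    exact ht (subset_closure (mem_biUnion hex hte))
  · have hopen : IsOpen (closure (⋃ e ∈ {e : B | idem e * x = 0}, basic e)) := by
      rw [← basic_sSup]
      exact (isClopen_basic _).isOpen
    refine closure_minimal (subset_compl_comm.1 ?_) hopen.isClosed_compl
    refine closure_minimal (iUnion₂_subset fun e he s hs hxs => hxs ?_)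
      (isOpen_ne.preimage x.continuous_toFun).isClosed_compl
    rw [← indicator_of_mem hs x.toFun, ← idem_mul_apply, he]
    rfl

variable {Y : Submodule ℝ (LZero B)} {δ : C(StoneSpace B, ℝ) →ₗ[ℝ] Y}

lemma basic_derivSupp (δ : C(StoneSpace B, ℝ) →ₗ[ℝ] Y) :
    basic (derivSupp δ) = closure (⋃ a, {t | (δ a : LZero B) t ≠ 0}) := by
  rw [derivSupp, iSup, basic_sSup, biUnion_range]
  simp only [basic_supp]
  exact Subset.antisymm
    (closure_minimal
      (iUnion_subset fun a => closure_mono (subset_iUnion_of_subset a subset_rfl)) isClosed_closure)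
    (closure_mono (iUnion_mono fun _ => subset_closure))

namespace IsDerivation

lemma map_eq_zero_of_isIdempotentElem (hδ : IsDerivation δ) {p : C(StoneSpace B, ℝ)}
    (hp : IsIdempotentElem p) : (δ p : LZero B) = 0 := by
  have hleibniz : (δ p : LZero B) = δ p * ofC p + ofC p * δ p := by rw [← hδ p p, hp.eq]
  have hsq : ofC p * ofC p = ofC p := by rw [← ofC_mul, hp.eq]
  have hmul : ofC p * (δ p : LZero B) = 0 := by
    linear_combination (-ofC p) * hleibniz - 2 * (δ p : LZero B) * hsq
  linear_combination hleibniz + 2 * hmul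

lemma map_const (hδ : IsDerivation δ) (c : ℝ) : δ (ContinuousMap.const _ c) = 0 := by
  have hc : ContinuousMap.const (StoneSpace B) c = c • 1 := by ext; simp
  have hone : δ 1 = 0 := Subtype.ext (hδ.map_eq_zero_of_isIdempotentElem .one)
  rw [hc, map_smul, hone, smul_zero]

lemma map_idemC_mul (hδ : IsDerivation δ) (e : B) (a : C(StoneSpace B, ℝ)) :
    (δ (idemC e * a) : LZero B) = idem e * δ a := by
  rw [hδ, hδ.map_eq_zero_of_isIdempotentElem (isIdempotentElem_idemC e), zero_mul, zero_add]
  rfl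

lemma map_idemC_mul_apply (hδ : IsDerivation δ) {e : B} (a : C(StoneSpace B, ℝ))
    {t : StoneSpace B} (ht : t ∈ basic e) :
    (δ (idemC e * a) : LZero B) t = (δ a : LZero B) t := by
  rw [hδ.map_idemC_mul, idem_mul_apply, indicator_of_mem ht]

lemma eqOn_of_isOpen (hδ : IsDerivation δ) {U : Set (StoneSpace B)} (hU : IsOpen U)
    {a b : C(StoneSpace B, ℝ)} (hab : EqOn a b U) :
    EqOn (δ a : LZero B) (δ b : LZero B) U := by
  intro t ht
  obtain ⟨e, hte, heU⟩ := exists_basic_subset hU ht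
  have hmul : idemC e * a = idemC e * b := by
    ext s
    rw [idemC_mul_apply, idemC_mul_apply, indicator_congr fun r hr => hab (heU hr)]
  rw [← hδ.map_idemC_mul_apply a hte, hmul, hδ.map_idemC_mul_apply b hte]

lemma exists_norm_le_one_apply_eq (hδ : IsDerivation δ) (b : C(StoneSpace B, ℝ))
    (t : StoneSpace B) :
    ∃ a : C(StoneSpace B, ℝ), ‖a‖ ≤ 1 ∧ (δ a : LZero B) t = (δ b : LZero B) t := by
  let b₀ : C(StoneSpace B, ℝ) := b - ContinuousMap.const _ (b t)
  obtain ⟨e, hte, he⟩ : ∃ e : B, t ∈ basic e ∧ basic e ⊆ {s | ‖b₀ s‖ < 1} :=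
    exists_basic_subset (isOpen_lt b₀.continuous.norm continuous_const) (by simp [b₀])
  refine ⟨idemC e * b₀, (ContinuousMap.norm_le _ zero_le_one).2 fun s => ?_, ?_⟩
  · rw [idemC_mul_apply]
    by_cases hs : s ∈ basic e
    · simpa [hs] using (he hs).le
    · simp [hs]
  · rw [hδ.map_idemC_mul_apply b₀ hte, map_sub, hδ.map_const, sub_zero]

lemma exists_norm_le_one_lt_abs_apply (hδ : IsDerivation δ) {b : C(StoneSpace B, ℝ)}
    {t : StoneSpace B} (hfin : t ∈ (δ b : LZero B).fin) (hne : (δ b : LZero B) t ≠ 0) (M : ℝ) :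
    ∃ a : C(StoneSpace B, ℝ), ‖a‖ ≤ 1 ∧ (M : EReal) < |(δ a : LZero B)| t := by
  have hre : (δ b : LZero B).re t ≠ 0 := fun h => hne (by rw [← coe_re _ hfin, h, EReal.coe_zero])
  obtain ⟨a, ha, hat⟩ :=
    hδ.exists_norm_le_one_apply_eq (((|M| + 1) / (δ b : LZero B).re t) • b) t
  refine ⟨a, ha, ?_⟩
  rw [abs_apply, hat, map_smul, Submodule.coe_smul, smul_apply_of_mem_fin _ hfin,
    div_mul_cancel₀ _ hre, EReal.coe_abs, EReal.coe_lt_coe_iff]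
  linarith [le_abs_self M, le_abs_self (|M| + 1)]

lemma exists_isOpen_abs_le (hδ : IsDerivation δ) (z : LZero B) {V : Set (StoneSpace B)}
    (hV : IsOpen V) (hVne : V.Nonempty) :
    ∃ U ⊆ V, IsOpen U ∧ U.Nonempty ∧ ∃ a : C(StoneSpace B, ℝ), ‖a‖ ≤ 1 ∧
      ∀ t ∈ U, |idem (derivSupp δ) * z| t ≤ |(δ a : LZero B)| t := by
  set w : LZero B := idem (derivSupp δ) * z with hw
  by_cases hdisj : Disjoint V (⋃ b, {t | (δ b : LZero B) t ≠ 0})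
  · refine ⟨V, subset_rfl, hV, hVne, 0, by simp, fun t ht => ?_⟩
    have hts : t ∉ basic (derivSupp δ) := by
      rw [basic_derivSupp]
      exact Set.disjoint_left.1 (hdisj.closure_right hV) ht
    rw [abs_apply, hw, idem_mul_apply, indicator_of_notMem hts, EReal.abs_zero, abs_apply]
    exact EReal.coe_ennreal_nonneg _
  · obtain ⟨s, hsV, hs⟩ := Set.not_disjoint_iff.1 hdisj
    obtain ⟨b, hb⟩ := mem_iUnion.1 hs
    obtain ⟨t, ⟨htV, htb⟩, hwt, hbt⟩ :=
      (w.dense_fin.inter_of_isOpen_left (δ b : LZero B).dense_fin w.isOpen_fin).inter_open_nonempty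
        _ (hV.inter (isOpen_ne.preimage (δ b : LZero B).continuous_toFun)) ⟨s, hsV, hb⟩
    obtain ⟨a, ha, hat⟩ := hδ.exists_norm_le_one_lt_abs_apply hbt htb |w.re t|
    refine ⟨V ∩ {r | |w| r < |(δ a : LZero B)| r}, inter_subset_left,
      hV.inter (isOpen_lt (|w|).continuous_toFun (|(δ a : LZero B)|).continuous_toFun),
      ⟨t, htV, ?_⟩, a, ha, fun r hr => hr.2.le⟩
    rwa [mem_ofPred_eq, abs_apply w, ← coe_re w hwt, EReal.coe_abs]

lemma exists_abs_idem_mul_le (hδ : IsDerivation δ) (z : LZero B) :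
    ∃ a : C(StoneSpace B, ℝ), |idem (derivSupp δ) * z| ≤ |(δ a : LZero B)| := by
  obtain ⟨S, hS, hdisj, hdense⟩ :=
    exists_pairwiseDisjoint_dense_sUnion fun _ => hδ.exists_isOpen_abs_le z
  choose A hA hle using fun U : S => (hS U U.2).2
  rw [sUnion_eq_iUnion] at hdense
  obtain ⟨a, ha⟩ := exists_continuousMap_eqOn_of_dense_iUnion (isCompact_closedBall (0 : ℝ) 1)
    (fun U : S => (hS U U.2).1) hdense A
    (fun U t => mem_closedBall_zero_iff.2 (((A U).norm_coe_le_norm t).trans (hA U)))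
    (fun U T t ht => by rw [Subtype.ext (hdisj.elim_set U.2 T.2 t ht.1 ht.2)])
  have hcl : IsClosed {t | |idem (derivSupp δ) * z| t ≤ |(δ a : LZero B)| t} :=
    isClosed_le (CInfty.continuous_toFun _) (CInfty.continuous_toFun _)
  refine ⟨a, fun t => closure_minimal (iUnion_subset fun U s hs => ?_) hcl (hdense t)⟩
  have hlocal : |(δ a : LZero B)| s = |(δ (A U) : LZero B)| s := by
    rw [abs_apply, abs_apply, hδ.eqOn_of_isOpen (hS U U.2).1 (ha U) hs]
  exact (hle U s hs).trans_eq hlocal.symm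

end IsDerivation

lemma IsSolidSpace.idem_derivSupp_mul_mem (hY : IsSolidSpace Y) (hδ : IsDerivation δ)
    (z : LZero B) : idem (derivSupp δ) * z ∈ Y :=
  let ⟨a, ha⟩ := hδ.exists_abs_idem_mul_le z
  hY.solid _ (δ a).2 _ ha

end LZero

theorem mainTheorem9 {B : Type*} [CompleteBooleanAlgebra B]
    (Y : Submodule ℝ (LZero B)) (hY : LZero.IsSolidSpace Y)
    (δ : C(StoneSpace B, ℝ) →ₗ[ℝ] Y) (hδ : LZero.IsDerivation δ) (hδ0 : δ ≠ 0) :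
    (fun y : LZero B => LZero.idem (LZero.derivSupp δ) * y) '' (Y : Set (LZero B)) =
        (fun y : LZero B => LZero.idem (LZero.derivSupp δ) * y) '' (Set.univ : Set (LZero B)) ∧
      (LZero.derivSupp δ = ⊤ → Y = ⊤) := by
  refine ⟨(Set.image_mono (Set.subset_univ _)).antisymm ?_, fun htop => ?_⟩
  · rintro _ ⟨z, -, rfl⟩
    refine ⟨_, hY.idem_derivSupp_mul_mem hδ z, ?_⟩
    simp only [← mul_assoc, (LZero.isIdempotentElem_idem _).eq]
  · refine Submodule.eq_top_iff'.2 fun z => ?_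
    simpa only [htop, LZero.idem_top, one_mul] using hY.idem_derivSupp_mul_mem hδ z
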